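/- Let $G$ be a totally disconnected locally compact (Hausdorff) topological group, let $\phi\colon G\to G$ be a continuous endomorphism, and let $H$ be a closed subgroup of $G$ that is $\phi$-stable, i.e. $\phi(H)=H$, and satisfies $\ker(\phi)\le H$. Suppose that $H$ is normal in $G$ or compact. Then $$h_{top}(\phi)=h_{top}(\phi\restriction_H)+h_{top}(\bar\phi)\qquad\text{in }[0,+\infty],$$ where $\phi\restriction_H\colon H\to H$ is the restriction of $\phi$, $G/H$ is the space of left cosets, and $\bar\phi\colon G/H\to G/H$, $xH\mapsto\phi(x)H$, is the map induced by $\phi$. Here $h_{top}$ is Hood's uniform entropy: for a uniformly continuous self-map $f$ of a uniform space $X$, $$h_{top}(f)=\sup_{K}\ \sup_{U}\ \limsup_{n\to\infty}\frac{\log r_n(f,U,K)}{n},$$ where $K$ runs over the compact subsets of $X$, $U$ runs over the entourages of $X$, and $r_n(f,U,K)$ is the least cardinality of a set $E\subseteq X$ such that for every $x\in K$ there is $e\in E$ with $(f^k(x),f^k(e))\in U$ for all $0\le k<n$. The groups $G$ and $H$ carry their left uniformities, with fundamental entourages $\{(x,y): y^{-1}x\in V\}$, and $G/H$ carries the left uniformity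 with fundamental entourages $\{(xH,yH): y^{-1}x\in V\}$, where $V$ runs over the neighbourhoods of $1$ (in $H$, respectively in $G$). -/

import Mathlib

open Filter Topology Uniformity SetRel

/-- Hood's (uniform) topological entropy of a self-map `f` of a uniform space `X`: the supremum,
over all compact subsets `K` of `X` and all entourages `U`, of the exponential growth rate (with a
`limsup`) of the least number of points of an `(n, U)`-spanning set for `K`, that is, of a set `E`
such that each `x ∈ K` satisfies, for some `e ∈ E`, that `f^[k] x` and `f^[k] e` are `U`-close
for all `k < n`. `Dynamics.coverEntropy f K` is the supremum over `U` for a fixed `K`. -/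
noncomputable def hoodEntropy {X : Type*} [UniformSpace X] (f : X → X) : EReal :=
  ⨆ (K : Set X) (_ : IsCompact K), Dynamics.coverEntropy f K

/-- For a normal or compact subgroup `H`, every neighbourhood `K` of `1` contains `h * l * h⁻¹`
up to right multiplication by `H`, for all `h ∈ H` and all `l` in some neighbourhood `L`
of `1`, i.e. `H L ⊆ K H`. -/
theorem exists_nhds_mul_subset {G : Type*} [Group G] [TopologicalSpace G] [IsTopologicalGroup G]
    {H : Subgroup G} (hH : H.Normal ∨ IsCompact (H : Set G)) {K : Set G} (hK : K ∈ 𝓝 (1 : G)) :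
    ∃ L ∈ 𝓝 (1 : G), ∀ h ∈ H, ∀ l ∈ L, ∃ k ∈ K, ∃ h' ∈ H, h * l = k * h' := by
  rcases hH with hN | hC
  · refine ⟨K, hK, fun h hh l hl => ⟨l, hl, l⁻¹ * h * l, ?_, by group⟩⟩
    simpa using hN.conj_mem h hh l⁻¹
  · have key : ∀ᶠ l in 𝓝 (1 : G), ∀ h ∈ (H : Set G), h * l * h⁻¹ ∈ K := by
      refine hC.eventually_forall_of_forall_eventually fun h _ => ?_
      have hcont : Continuous fun p : G × G => p.2 * p.1 * p.2⁻¹ := by fun_prop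
      have := hcont.tendsto ((1 : G), h)
      simp only [mul_one, mul_inv_cancel] at this
      exact this hK
    exact ⟨_, key, fun h hh l hl => ⟨h * l * h⁻¹, hl h hh, h, hh, by group⟩⟩

/-- The left uniformity of the space `G ⧸ H` of left cosets, for `H` normal or compact: a
fundamental system of entourages is given by the sets of all pairs `(xH, yH)` with `x⁻¹ * y ∈ K`,
where `K` is a neighbourhood of `1`, i.e. by the images of the entourages of the left uniformity
of `G`. Its topology is the quotient topology. -/
@[reducible] def quotientLeftUniformSpace {G : Type*} [Group G] [TopologicalSpace G]
    [IsTopologicalGroup G] (H : Subgroup G) (hH : H.Normal ∨ IsCompact (H : Set G)) :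
    UniformSpace (G ⧸ H) where
  toTopologicalSpace := inferInstance
  uniformity := Filter.map (Prod.map (QuotientGroup.mk (s := H)) (QuotientGroup.mk (s := H)))
    (@uniformity G (IsTopologicalGroup.leftUniformSpace G))
  symm := by
    let _ : UniformSpace G := IsTopologicalGroup.leftUniformSpace G
    rw [Filter.tendsto_map'_iff]
    exact (Filter.tendsto_map (f := Prod.map (QuotientGroup.mk (s := H))
      (QuotientGroup.mk (s := H)))).comp (tendsto_swap_uniformity (α := G))
  comp := by
    intro W hW
    obtain ⟨K, hK, hKW⟩ := Filter.mem_comap.1 (Filter.mem_map.1 hW)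
    obtain ⟨V, hV, hVK⟩ := exists_nhds_one_split hK
    obtain ⟨L, hL, hLV⟩ := exists_nhds_mul_subset hH hV
    refine Filter.mem_of_superset (Filter.mem_lift' (t := Prod.map (QuotientGroup.mk (s := H))
      (QuotientGroup.mk (s := H)) '' ((fun p : G × G => p.1⁻¹ * p.2) ⁻¹' (V ∩ L)))
      (Filter.image_mem_map (Filter.preimage_mem_comap (Filter.inter_mem hV hL)))) ?_
    rintro ⟨a, c⟩ ⟨b, ⟨⟨x, y⟩, hxy, h1⟩, ⟨⟨y', z⟩, hyz, h2⟩⟩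
    simp only [Prod.map_apply, Prod.mk.injEq] at h1 h2
    obtain ⟨rfl, hb⟩ := h1
    obtain ⟨hb', rfl⟩ := h2
    have hmem : y⁻¹ * y' ∈ H := QuotientGroup.eq.1 (hb.trans hb'.symm)
    obtain ⟨k, hk, h', hh', he⟩ := hLV _ hmem (y'⁻¹ * z) hyz.2
    have hz : (QuotientGroup.mk z : G ⧸ H) = QuotientGroup.mk (y * k) := by
      refine (QuotientGroup.eq.2 ?_).symm
      have : (y * k)⁻¹ * z = h' := by
        have h3 : z = y * (k * h') := by rw [← he]; group
        rw [h3]; group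
      rwa [this]
    have : (x, y * k) ∈ Prod.map (QuotientGroup.mk (s := H)) (QuotientGroup.mk (s := H)) ⁻¹' W := by
      refine hKW ?_
      have := hVK _ hxy.1 _ hk
      simpa [mul_assoc] using this
    rw [hz]
    exact this
  nhds_eq_comap_uniformity := by
    intro q
    obtain ⟨x, rfl⟩ := QuotientGroup.mk_surjective q
    let _ : UniformSpace G := IsTopologicalGroup.leftUniformSpace G
    rw [QuotientGroup.nhds_eq]
    apply le_antisymm
    · rw [← Filter.map_le_iff_le_comap, Filter.map_map]
      have : (Prod.mk (QuotientGroup.mk x : G ⧸ H)) ∘ (QuotientGroup.mk (s := H)) =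
          Prod.map (QuotientGroup.mk (s := H)) (QuotientGroup.mk (s := H)) ∘ Prod.mk x := rfl
      rw [this, ← Filter.map_map]
      refine Filter.map_mono ?_
      rw [nhds_eq_comap_uniformity, Filter.map_le_iff_le_comap]
    · intro S hS
      rw [Filter.mem_map, nhds_eq_comap_uniformity] at hS
      obtain ⟨W, hW, hWS⟩ := hS
      obtain ⟨K, hK, hKW⟩ := Filter.mem_comap.1 hW
      obtain ⟨L, hL, hLK⟩ := exists_nhds_mul_subset hH hK
      refine ⟨_, Filter.image_mem_map (Filter.preimage_mem_comap hL), ?_⟩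
      rintro c ⟨⟨x', z⟩, hxz, he⟩
      simp only [Prod.map_apply, Prod.mk.injEq] at he
      obtain ⟨hx, rfl⟩ := he
      obtain ⟨k, hk, h', hh', hkh⟩ := hLK _ (QuotientGroup.eq.1 hx.symm) (x'⁻¹ * z) hxz
      have hz : (QuotientGroup.mk z : G ⧸ H) = QuotientGroup.mk (x * k) := by
        refine (QuotientGroup.eq.2 ?_).symm
        have : (x * k)⁻¹ * z = h' := by
          have h3 : z = x * (k * h') := by rw [← hkh]; group
          rw [h3]; group
        rwa [this]
      have : x * k ∈ QuotientGroup.mk (s := H) ⁻¹' S := by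
        refine hWS (hKW ?_)
        simpa using hk
      rw [hz]
      exact this

/-- The restriction `φ|_H : H → H` of an endomorphism with `φ H ≤ H`. -/
def restrictMap {G : Type*} [Group G] (φ : G →* G) (H : Subgroup G) (hφ : H.map φ ≤ H) :
    H → H :=
  fun x => ⟨φ x, hφ (Subgroup.mem_map_of_mem φ x.2)⟩

/-- The map `xH ↦ φ(x)H` induced on `G ⧸ H` by an endomorphism with `φ H ≤ H`. -/
def quotientMap {G : Type*} [Group G] (φ : G →* G) (H : Subgroup G) (hφ : H.map φ ≤ H) :
    G ⧸ H → G ⧸ H :=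
  Quotient.map' φ fun x y hxy => by
    rw [QuotientGroup.leftRel_apply] at hxy ⊢
    have := hφ (Subgroup.mem_map_of_mem φ hxy)
    simpa using this

/-!
The dynamical balls of the left uniformity attached to an open subgroup `U` are the cosets of
the groups `C n = {x | x, φ x, …, φ^[n - 1] x ∈ U}`, so `φ` has entropy `limsup (log [U : C n]) / n`
at `U`. The successive ratios of these indices are `[φ (U n) : φ (U n) ∩ U]`, where `U n` is the set
of endpoints of trajectories of length `n + 1` in `U`. They decrease, hence are eventually constant,
and the limsup is a limit. By compactness the limit ratio is `[φ U₊ : U₊]`, where `U₊ = ⋂ n, U n`.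

When `H` is normal or compact, the compact open subgroups `U` such that `H` is normal or normalizes
`U` form a basis at `1`, and for those the index is multiplicative: `[B : A]` is the product of
`[B ∩ H : A ∩ H]` and `[BH : AH]`. Comparing the dynamical balls of `U`, `U ∩ H` and `UH` gives
the inequality `≥`, since the growth rates are limits. Applying multiplicativity to `U₊ ≤ φ U₊`
gives `≤`: the assumptions `φ H = H` and `ker φ ≤ H` turn the two factors into
`[φ (U₊ ∩ H) : U₊ ∩ H]` and `[φ (U₊ H) : U₊ H]`, which bound from below the entropies of the
restriction and of the quotient map.
-/

open scoped Pointwise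

open Subgroup Dynamics ExpGrowth

section RelIndex

variable {G : Type*} [Group G]

theorem image_mk_subset_image_mk_iff {C : Subgroup G} {K K' : Set G} :
    (QuotientGroup.mk '' K : Set (G ⧸ C)) ⊆ QuotientGroup.mk '' K' ↔ K ⊆ K' * C := by
  rw [Set.image_subset_iff]
  refine forall₂_congr fun x _ => ?_
  simp only [Set.mem_preimage, Set.mem_image, QuotientGroup.eq, Set.mem_mul, SetLike.mem_coe]
  exact exists_congr fun z => and_congr_right fun _ =>
    ⟨fun h => ⟨_, h, mul_inv_cancel_left z x⟩, by rintro ⟨c, hc, rfl⟩; simpa using hc⟩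

theorem relIndex_eq_ncard_image_mk (C D : Subgroup G) :
    C.relIndex D = (QuotientGroup.mk '' (D : Set G) : Set (G ⧸ C)).ncard := by
  have hsmul (d : D) : d • (QuotientGroup.mk 1 : G ⧸ C) = QuotientGroup.mk (d : G) :=
    congrArg QuotientGroup.mk (mul_one (d : G))
  have hstab : MulAction.stabilizer D (QuotientGroup.mk 1 : G ⧸ C) = C.subgroupOf D := by
    ext d
    rw [MulAction.mem_stabilizer_iff, hsmul, eq_comm, QuotientGroup.eq, inv_one, one_mul,
      mem_subgroupOf]
  rw [relIndex, ← hstab, MulAction.index_stabilizer, MulAction.orbit, Set.image_eq_range]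
  simp only [hsmul]
  rfl

theorem coe_relIndex_eq_encard_image_mk {C D : Subgroup G} (h : C.relIndex D ≠ 0) :
    (C.relIndex D : ℕ∞) = (QuotientGroup.mk '' (D : Set G) : Set (G ⧸ C)).encard := by
  rw [relIndex_eq_ncard_image_mk] at h ⊢
  exact (Set.finite_of_ncard_ne_zero h).cast_ncard_eq

theorem coe_relIndex_le_encard_image_mk {C C' D : Subgroup G} (h : D ⊓ C' ≤ C) :
    (C.relIndex D : ℕ∞) ≤ (QuotientGroup.mk '' (D : Set G) : Set (G ⧸ C')).encard := by
  rcases (QuotientGroup.mk '' (D : Set G) : Set (G ⧸ C')).finite_or_infinite with hfin | hinf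
  · have h0 : C'.relIndex D ≠ 0 := by
      rw [relIndex_eq_ncard_image_mk]
      exact Set.ncard_ne_zero_of_mem (Set.mem_image_of_mem _ D.one_mem) hfin
    rw [← coe_relIndex_eq_encard_image_mk h0, Nat.cast_le, ← inf_relIndex_left D C']
    exact relIndex_le_of_le_left h (by rwa [inf_relIndex_left])
  · rw [hinf.encard_eq]
    exact le_top

theorem relIndex_eq_of_subset_mul {U K K' : Subgroup G} (h : K' ≤ K)
    (hK : (K : Set G) ⊆ K' * U) : U.relIndex K' = U.relIndex K := by
  simp only [relIndex_eq_ncard_image_mk]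
  rw [(Set.image_mono h).antisymm (image_mk_subset_image_mk_iff.2 hK)]

theorem subset_mul_of_relIndex_eq {U K K' : Subgroup G} (h : K' ≤ K) (h0 : U.relIndex K ≠ 0)
    (hK : U.relIndex K' = U.relIndex K) : (K : Set G) ⊆ K' * U := by
  simp only [relIndex_eq_ncard_image_mk] at h0 hK
  exact image_mk_subset_image_mk_iff.1 (Set.eq_of_subset_of_ncard_le (Set.image_mono h) hK.ge
    (Set.finite_of_ncard_ne_zero h0)).ge

theorem map_inf_comap (φ : G →* G) (A B : Subgroup G) :
    (A ⊓ B.comap φ).map φ = A.map φ ⊓ B :=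
  SetLike.coe_injective (Set.image_inter_preimage φ A B)

theorem map_inf_of_ker_le {φ : G →* G} {H : Subgroup G} (hstable : H.map φ = H)
    (hker : φ.ker ≤ H) (A : Subgroup G) : (A ⊓ H).map φ = A.map φ ⊓ H := by
  have hcomap : H.comap φ = H := by
    conv_lhs => rw [← hstable, comap_map_eq, sup_of_le_left hker]
  conv_lhs => rw [← hcomap, map_inf_comap]

end RelIndex

/-- `H` is normal, or it normalizes `A`. In both cases the product set `A * H` is a subgroup, and
this persists under intersections and under endomorphisms mapping `H` onto itself. -/
def NormalOrNormalizes {G : Type*} [Group G] (H A : Subgroup G) : Prop :=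
  H.Normal ∨ H ≤ normalizer (A : Set G)

namespace NormalOrNormalizes

variable {G : Type*} [Group G] {H A B : Subgroup G}

theorem coe_sup (hA : NormalOrNormalizes H A) : ((A ⊔ H : Subgroup G) : Set G) = A * H := by
  rcases hA with hH | hH
  · exact mul_normal A H
  · exact coe_mul_of_right_le_normalizer_left A H hH

theorem coe_sup' (hA : NormalOrNormalizes H A) : ((A ⊔ H : Subgroup G) : Set G) = H * A := by
  rw [sup_comm]
  rcases hA with hH | hH
  · exact normal_mul H A
  · exact coe_mul_of_left_le_normalizer_right H A hH

theorem inf (hA : NormalOrNormalizes H A) (hB : NormalOrNormalizes H B) :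
    NormalOrNormalizes H (A ⊓ B) := by
  by_cases h : H.Normal
  · exact Or.inl h
  · exact Or.inr ((le_inf (hA.resolve_left h) (hB.resolve_left h)).trans
      inf_normalizer_le_normalizer_inf)

theorem iInf {ι : Sort*} {A : ι → Subgroup G} (hA : ∀ i, NormalOrNormalizes H (A i)) :
    NormalOrNormalizes H (⨅ i, A i) := by
  by_cases h : H.Normal
  · exact Or.inl h
  · exact Or.inr ((le_iInf fun i => (hA i).resolve_left h).trans
      (iInf_normalizer_le_normalizer_iInf A))

theorem map {φ : G →* G} (hA : NormalOrNormalizes H A) (hφ : H.map φ = H) :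
    NormalOrNormalizes H (A.map φ) := by
  refine hA.imp id fun hA => ?_
  conv_lhs => rw [← hφ]
  exact (Subgroup.map_mono hA).trans (le_normalizer_map φ)

theorem image_mk_sup {C : Subgroup G} (hA : NormalOrNormalizes H A) (hC : H ≤ C) :
    (QuotientGroup.mk '' ((A ⊔ H : Subgroup G) : Set G) : Set (G ⧸ C)) =
      QuotientGroup.mk '' (A : Set G) := by
  refine Set.Subset.antisymm (image_mk_subset_image_mk_iff.2 ?_)
    (Set.image_mono (le_sup_left (a := A)))
  rw [hA.coe_sup]
  exact Set.mul_subset_mul_left hC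

theorem relIndex_sup {C : Subgroup G} (hA : NormalOrNormalizes H A) (hC : H ≤ C) :
    C.relIndex (A ⊔ H) = C.relIndex A := by
  simp only [relIndex_eq_ncard_image_mk, hA.image_mk_sup hC]

theorem relIndex_eq_mul (hA : NormalOrNormalizes H A) (hB : NormalOrNormalizes H B) (hAB : A ≤ B) :
    A.relIndex B = A.relIndex (B ⊓ H) * (A ⊔ H).relIndex (B ⊔ H) := by
  have hinter : A.relIndex (B ⊓ H) = A.relIndex ((A ⊔ H) ⊓ B) := by
    refine relIndex_eq_of_subset_mul (le_inf (inf_le_right.trans le_sup_right) inf_le_left) ?_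
    rw [coe_inf, hA.coe_sup', Set.inter_comm]
    exact (inf_mul_assoc B H A hAB).ge
  rw [hinter, hB.relIndex_sup le_sup_right, relIndex_inf_mul_relIndex,
    inf_of_le_left le_sup_left]

end NormalOrNormalizes

section Trajectories

variable {G : Type*} [Group G]

/-- The subgroup of all `x` whose first `n` iterates `x, φ x, …, φ^[n - 1] x` lie in `W`. Its
cosets are the dynamical balls of the left uniformity of `G`. -/
def cotrajectory (φ : G →* G) (W : Subgroup G) : ℕ → Subgroup G
  | 0 => ⊤
  | n + 1 => W ⊓ (cotrajectory φ W n).comap φ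

/-- The subgroup of all endpoints `φ^[n] x` of trajectories `x, φ x, …, φ^[n] x` of length `n + 1`
inside `W`. -/
def trajectoryEnd (φ : G →* G) (W : Subgroup G) : ℕ → Subgroup G
  | 0 => W
  | n + 1 => W ⊓ (trajectoryEnd φ W n).map φ

variable {φ : G →* G} {W D H : Subgroup G}

theorem mem_cotrajectory {n : ℕ} {x : G} : x ∈ cotrajectory φ W n ↔ ∀ k < n, φ^[k] x ∈ W := by
  induction n generalizing x with
  | zero => simp [cotrajectory]
  | succ n ih =>
    simp only [cotrajectory, mem_inf, Subgroup.mem_comap, ih, Nat.forall_lt_succ_left,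
      Function.iterate_zero_apply, Function.iterate_succ_apply]

theorem cotrajectory_mono {W' : Subgroup G} (h : W ≤ W') (n : ℕ) :
    cotrajectory φ W n ≤ cotrajectory φ W' n :=
  fun _ hx => mem_cotrajectory.2 fun k hk => h (mem_cotrajectory.1 hx k hk)

theorem le_cotrajectory (hφ : H.map φ ≤ H) (hW : H ≤ W) (n : ℕ) : H ≤ cotrajectory φ W n := by
  induction n with
  | zero => exact le_top
  | succ n ih => exact le_inf hW (map_le_iff_le_comap.1 (hφ.trans ih))

theorem inf_cotrajectory_le (hD : D.map φ ⊓ W ≤ D) (n : ℕ) :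
    D ⊓ cotrajectory φ W n ≤ cotrajectory φ D n := by
  induction n with
  | zero => exact le_top
  | succ n ih =>
    rintro x ⟨hxD, -, hx⟩
    refine ⟨hxD, ?_⟩
    cases n with
    | zero => exact mem_top _
    | succ n => exact ih ⟨hD ⟨mem_map_of_mem φ hxD, hx.1⟩, hx⟩

theorem trajectoryEnd_le (n : ℕ) : trajectoryEnd φ W n ≤ W := by
  cases n with
  | zero => exact le_rfl
  | succ n => exact inf_le_left

theorem trajectoryEnd_antitone : Antitone (trajectoryEnd φ W) := by
  refine antitone_nat_of_succ_le fun n => ?_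
  induction n with
  | zero => exact inf_le_left
  | succ n ih => exact inf_le_inf_left W (Subgroup.map_mono ih)

theorem trajectoryEnd_eq_self (hD : D ≤ D.map φ) (n : ℕ) : trajectoryEnd φ D n = D := by
  induction n with
  | zero => rfl
  | succ n ih => rw [trajectoryEnd, ih, inf_of_le_left hD]

theorem relIndex_cotrajectory_trajectoryEnd (n k : ℕ) :
    (cotrajectory φ W (n + 1)).relIndex (trajectoryEnd φ W k) =
      ∏ i ∈ Finset.range n, W.relIndex ((trajectoryEnd φ W (k + i)).map φ) := by
  induction n generalizing k with
  | zero =>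
    simpa [cotrajectory] using trajectoryEnd_le k
  | succ n ih =>
    have hle : cotrajectory φ W (n + 1) ≤ W := inf_le_left
    rw [cotrajectory, ← inf_relIndex_right, inf_right_comm,
      inf_of_le_right (trajectoryEnd_le k), inf_comm, inf_relIndex_right, relIndex_comap,
      ← inf_of_le_left hle, ← relIndex_inf_mul_relIndex, ← trajectoryEnd, ih,
      Finset.prod_range_succ']
    simp only [add_zero, Nat.succ_add_eq_add_succ]

theorem relIndex_cotrajectory_succ (n : ℕ) :
    (cotrajectory φ W (n + 2)).relIndex W =
      W.relIndex ((trajectoryEnd φ W n).map φ) * (cotrajectory φ W (n + 1)).relIndex W := by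
  have hprod (m : ℕ) := relIndex_cotrajectory_trajectoryEnd (φ := φ) (W := W) m 0
  simp only [trajectoryEnd, zero_add] at hprod
  rw [hprod, hprod, Finset.prod_range_succ, mul_comm]

theorem relIndex_cotrajectory_of_le_map (hD : D ≤ D.map φ) (n : ℕ) :
    (cotrajectory φ D (n + 1)).relIndex D = D.relIndex (D.map φ) ^ n := by
  simpa [trajectoryEnd_eq_self hD] using
    relIndex_cotrajectory_trajectoryEnd (φ := φ) (W := D) n 0

theorem exists_eventually_relIndex_map_trajectoryEnd
    (hfin : ∀ n, (cotrajectory φ W n).relIndex W ≠ 0) :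
    ∃ α ≠ 0, ∀ᶠ n in atTop, W.relIndex ((trajectoryEnd φ W n).map φ) = α := by
  have h0 (n : ℕ) : W.relIndex ((trajectoryEnd φ W n).map φ) ≠ 0 := fun h =>
    hfin (n + 2) (by rw [relIndex_cotrajectory_succ, h, zero_mul])
  have hanti : Antitone fun n => W.relIndex ((trajectoryEnd φ W n).map φ) := fun m n hmn =>
    relIndex_le_of_le_right (Subgroup.map_mono (trajectoryEnd_antitone hmn)) (h0 m)
  obtain ⟨N, hN⟩ := WellFoundedLT.antitone_chain_condition hanti
  exact ⟨_, h0 N, eventually_atTop.2 ⟨N, fun n hn => (hN n hn).symm⟩⟩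

theorem eventually_relIndex_cotrajectory_succ {α : ℕ}
    (hlim : ∀ᶠ n in atTop, W.relIndex ((trajectoryEnd φ W n).map φ) = α) :
    ∀ᶠ n in atTop, (cotrajectory φ W (n + 1)).relIndex W = α * (cotrajectory φ W n).relIndex W := by
  rw [← map_add_atTop_eq_nat 1, eventually_map]
  filter_upwards [hlim] with n hn
  rw [relIndex_cotrajectory_succ, hn]

theorem relIndex_cotrajectory_mul_le (hφ : H.map φ ≤ H) {U : Subgroup G}
    (hU : NormalOrNormalizes H U) {n : ℕ} (hfin : (cotrajectory φ U n).relIndex U ≠ 0) :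
    (cotrajectory φ U n).relIndex (U ⊓ H) * (cotrajectory φ (U ⊔ H) n).relIndex (U ⊔ H) ≤
      (cotrajectory φ U n).relIndex U := by
  have hH : H ≤ cotrajectory φ (U ⊔ H) n := le_cotrajectory hφ le_sup_right n
  have hmul := relIndex_inf_mul_relIndex (cotrajectory φ U n) (cotrajectory φ (U ⊔ H) n) U
  rw [inf_of_le_left (cotrajectory_mono le_sup_left n)] at hmul
  rw [hU.relIndex_sup hH, ← hmul]
  refine Nat.mul_le_mul_right _ (relIndex_le_of_le_right
    (le_inf (inf_le_right.trans hH) inf_le_left) fun h0 => hfin ?_)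
  rw [← hmul, h0, zero_mul]

end Trajectories

section ExpGrowth

variable {u : ℕ → ℕ} {a : ℕ}

theorem exists_eventually_eq_pow_mul (hu : ∀ᶠ n in atTop, u (n + 1) = a * u n) :
    ∃ N, ∀ k, u (N + k) = a ^ k * u N := by
  obtain ⟨N, hN⟩ := eventually_atTop.1 hu
  refine ⟨N, fun k => ?_⟩
  induction k with
  | zero => simp
  | succ k ih => rw [← add_assoc, hN _ (Nat.le_add_right N k), ih, pow_succ', mul_assoc]

theorem expGrowthSup_le_log_of_eventually_succ_eq_mul (h0 : ∀ n, u n ≠ 0)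
    (hu : ∀ᶠ n in atTop, u (n + 1) = a * u n) :
    expGrowthSup (fun n => (u n : ENNReal)) ≤ ENNReal.log a := by
  have ha : a ≠ 0 := by
    rintro rfl
    obtain ⟨n, hn⟩ := hu.exists
    exact h0 (n + 1) (by rw [hn, zero_mul])
  obtain ⟨N, hN⟩ := exists_eventually_eq_pow_mul hu
  rw [← expGrowthSup_pow]
  refine expGrowthSup_le_of_eventually_le (b := (u N : ENNReal)) (ENNReal.natCast_ne_top _)
    (eventually_atTop.2 ⟨N, fun n hn => ?_⟩)
  obtain ⟨k, rfl⟩ := Nat.exists_eq_add_of_le hn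
  rw [hN, mul_comm]
  norm_cast
  exact Nat.mul_le_mul_left _ (Nat.pow_le_pow_right (Nat.pos_of_ne_zero ha) (Nat.le_add_left k N))

theorem log_le_expGrowthInf_of_eventually_succ_eq_mul (h0 : ∀ n, u n ≠ 0)
    (hu : ∀ᶠ n in atTop, u (n + 1) = a * u n) :
    ENNReal.log a ≤ expGrowthInf fun n => (u n : ENNReal) := by
  obtain ⟨N, hN⟩ := exists_eventually_eq_pow_mul hu
  rw [← expGrowthInf_pow]
  refine expGrowthInf_le_of_eventually_le (b := ((a ^ N : ℕ) : ENNReal))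
    (ENNReal.natCast_ne_top _) (eventually_atTop.2 ⟨N, fun n hn => ?_⟩)
  obtain ⟨k, rfl⟩ := Nat.exists_eq_add_of_le hn
  rw [hN, pow_add]
  norm_cast
  exact Nat.mul_le_mul_left _ (Nat.le_mul_of_pos_right _ (Nat.pos_of_ne_zero (h0 N)))

theorem expGrowthSup_eq_log_of_eventually_succ_eq_mul (h0 : ∀ n, u n ≠ 0)
    (hu : ∀ᶠ n in atTop, u (n + 1) = a * u n) :
    expGrowthSup (fun n => (u n : ENNReal)) = ENNReal.log a :=
  (expGrowthSup_le_log_of_eventually_succ_eq_mul h0 hu).antisymm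
    ((log_le_expGrowthInf_of_eventually_succ_eq_mul h0 hu).trans expGrowthInf_le_expGrowthSup)

theorem expGrowthInf_eq_log_of_eventually_succ_eq_mul (h0 : ∀ n, u n ≠ 0)
    (hu : ∀ᶠ n in atTop, u (n + 1) = a * u n) :
    expGrowthInf (fun n => (u n : ENNReal)) = ENNReal.log a :=
  (expGrowthInf_le_expGrowthSup.trans
    (expGrowthSup_le_log_of_eventually_succ_eq_mul h0 hu)).antisymm
    (log_le_expGrowthInf_of_eventually_succ_eq_mul h0 hu)

end ExpGrowth

/-- The entourage of all pairs `(x, y)` with `x⁻¹ * y ∈ W`, the basic entourages of a left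
uniformity: for a subgroup `W`, the pairs lying in the same left coset of `W`. -/
def leftCosetRel {G : Type*} [Group G] (W : Subgroup G) : SetRel G G := {q | q.1⁻¹ * q.2 ∈ W}

section CoverEntropy

variable {G : Type*} [Group G] {φ : G →* G} {W D L : Subgroup G} {F : Set G}

theorem leftCosetRel_mono {W' : Subgroup G} (h : W ≤ W') : leftCosetRel W ⊆ leftCosetRel W' :=
  fun _ hq => h hq

theorem dynEntourage_leftCosetRel (n : ℕ) :
    dynEntourage φ (leftCosetRel W) n = leftCosetRel (cotrajectory φ W n) := by
  ext ⟨x, y⟩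
  simp only [mem_dynEntourage, leftCosetRel, Set.mem_ofPred_eq, mem_cotrajectory,
    iterate_map_mul, iterate_map_inv]

theorem coverMincard_leftCosetRel (F : Set G) (n : ℕ) :
    coverMincard φ F (leftCosetRel W) n =
      (QuotientGroup.mk '' F : Set (G ⧸ cotrajectory φ W n)).encard := by
  have hcover (s : Set G) : IsDynCoverOf φ F (leftCosetRel W) n s ↔
      (QuotientGroup.mk '' F : Set (G ⧸ cotrajectory φ W n)) ⊆ QuotientGroup.mk '' s := by
    rw [Set.image_subset_iff, IsDynCoverOf, dynEntourage_leftCosetRel]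
    refine forall₂_congr fun x _ => exists_congr fun y => and_congr_right fun _ => ?_
    rw [eq_comm, QuotientGroup.eq]
    rfl
  apply le_antisymm
  · obtain ⟨s, -, hs⟩ :=
      F.exists_subset_bijOn (QuotientGroup.mk : G → G ⧸ cotrajectory φ W n)
    rw [← hs.image_eq, hs.injOn.encard_image]
    rcases s.finite_or_infinite with hfin | hinf
    · lift s to Finset G using hfin
      rw [Set.encard_coe_eq_coe_finsetCard]
      exact ((hcover _).2 hs.image_eq.ge).coverMincard_le_card
    · rw [hinf.encard_eq]
      exact le_top
  · refine le_iInf₂ fun s hs => ?_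
    rw [← Set.encard_coe_eq_coe_finsetCard]
    exact (Set.encard_le_encard ((hcover _).1 hs)).trans (Set.encard_image_le _ _)

theorem coverMincard_subgroup_leftCosetRel {n : ℕ} (h : (cotrajectory φ W n).relIndex D ≠ 0) :
    coverMincard φ D (leftCosetRel W) n = (cotrajectory φ W n).relIndex D := by
  rw [coverMincard_leftCosetRel, coe_relIndex_eq_encard_image_mk h]

theorem exists_coverMincard_leftCosetRel_le
    (hF : (QuotientGroup.mk '' F : Set (G ⧸ W)).Finite) (hFL : F ⊆ L) :
    ∃ b : ℕ, ∀ n, coverMincard φ F (leftCosetRel W) n ≤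
      b * coverMincard φ (W ⊓ L : Subgroup G) (leftCosetRel W) n := by
  obtain ⟨t, htF, ht⟩ := F.exists_subset_bijOn (QuotientGroup.mk : G → G ⧸ W)
  lift t to Finset G using ht.finite_iff_finite.2 hF
  refine ⟨t.card, fun n => ?_⟩
  simp only [coverMincard_leftCosetRel]
  have hsub : (QuotientGroup.mk '' F : Set (G ⧸ cotrajectory φ W n)) ⊆
      ⋃ y ∈ t, y • (QuotientGroup.mk '' ((W ⊓ L : Subgroup G) : Set G)) := by
    rintro _ ⟨x, hx, rfl⟩
    obtain ⟨y, hy, hyx⟩ := ht.surjOn (Set.mem_image_of_mem _ hx)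
    refine Set.mem_iUnion₂.2 ⟨y, hy, _, ⟨y⁻¹ * x, ⟨QuotientGroup.eq.1 hyx, ?_⟩, rfl⟩, ?_⟩
    · exact L.mul_mem (L.inv_mem (hFL (htF hy))) (hFL hx)
    · exact congrArg QuotientGroup.mk (mul_inv_cancel_left y x)
  refine (Set.encard_le_encard hsub).trans ((t.set_encard_biUnion_le _).trans ?_)
  simp [Set.encard_smul_set]

theorem coverEntropyEntourage_leftCosetRel_le
    (hF : (QuotientGroup.mk '' F : Set (G ⧸ W)).Finite) (hFL : F ⊆ L) :
    coverEntropyEntourage φ F (leftCosetRel W) ≤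
      coverEntropyEntourage φ (W ⊓ L : Subgroup G) (leftCosetRel W) := by
  obtain ⟨b, hb⟩ := exists_coverMincard_leftCosetRel_le (φ := φ) hF hFL
  refine expGrowthSup_le_of_eventually_le (b := (b : ENNReal)) (ENNReal.natCast_ne_top _)
    (Eventually.of_forall fun n => ?_)
  simpa using ENat.toENNReal_mono (hb n)

theorem coverEntropyEntourage_subgroup_leftCosetRel_le (h0 : W.relIndex D ≠ 0) (hDL : D ≤ L) :
    coverEntropyEntourage φ D (leftCosetRel W) ≤
      coverEntropyEntourage φ (W ⊓ L : Subgroup G) (leftCosetRel W) := by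
  rw [relIndex_eq_ncard_image_mk] at h0
  exact coverEntropyEntourage_leftCosetRel_le (Set.finite_of_ncard_ne_zero h0) hDL

theorem coverEntropyEntourage_leftCosetRel_anti {W' : Subgroup G} (h : W' ≤ W)
    (h0 : W'.relIndex (W ⊓ L) ≠ 0) :
    coverEntropyEntourage φ (W ⊓ L : Subgroup G) (leftCosetRel W) ≤
      coverEntropyEntourage φ (W' ⊓ L : Subgroup G) (leftCosetRel W') :=
  (coverEntropyEntourage_antitone φ _ (leftCosetRel_mono h)).trans
    (coverEntropyEntourage_subgroup_leftCosetRel_le h0 inf_le_right)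

theorem coverEntropyEntourage_eq_log {α : ℕ} (hfin : ∀ n, (cotrajectory φ W n).relIndex W ≠ 0)
    (hlim : ∀ᶠ n in atTop, W.relIndex ((trajectoryEnd φ W n).map φ) = α) :
    coverEntropyEntourage φ W (leftCosetRel W) = ENNReal.log α := by
  rw [coverEntropyEntourage, ← expGrowthSup_eq_log_of_eventually_succ_eq_mul hfin
    (eventually_relIndex_cotrajectory_succ hlim)]
  simp only [coverMincard_subgroup_leftCosetRel (hfin _), ENat.toENNReal_coe]

theorem coverEntropyInfEntourage_eq_log {α : ℕ} (hfin : ∀ n, (cotrajectory φ W n).relIndex W ≠ 0)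
    (hlim : ∀ᶠ n in atTop, W.relIndex ((trajectoryEnd φ W n).map φ) = α) :
    coverEntropyInfEntourage φ W (leftCosetRel W) = ENNReal.log α := by
  rw [coverEntropyInfEntourage, ← expGrowthInf_eq_log_of_eventually_succ_eq_mul hfin
    (eventually_relIndex_cotrajectory_succ hlim)]
  simp only [coverMincard_subgroup_leftCosetRel (hfin _), ENat.toENNReal_coe]

theorem coverEntropyInfEntourage_eq_coverEntropyEntourage
    (hfin : ∀ n, (cotrajectory φ W n).relIndex W ≠ 0) :
    coverEntropyInfEntourage φ W (leftCosetRel W) =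
      coverEntropyEntourage φ W (leftCosetRel W) := by
  obtain ⟨α, -, hlim⟩ := exists_eventually_relIndex_map_trajectoryEnd hfin
  rw [coverEntropyInfEntourage_eq_log hfin hlim, coverEntropyEntourage_eq_log hfin hlim]

theorem log_relIndex_le_coverEntropyEntourage (hD : D ≤ D.map φ) (hDW : D.map φ ⊓ W ≤ D) :
    ENNReal.log (D.relIndex (D.map φ)) ≤ coverEntropyEntourage φ D (leftCosetRel W) := by
  rw [← expGrowthSup_pow]
  refine expGrowthSup_le_of_eventually_le (b := (D.relIndex (D.map φ) : ENNReal))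
    (ENNReal.natCast_ne_top _) (eventually_atTop.2 ⟨1, fun n hn => ?_⟩)
  obtain ⟨k, rfl⟩ := Nat.exists_eq_add_of_le' hn
  have hle := coe_relIndex_le_encard_image_mk (inf_cotrajectory_le hDW (k + 1))
  rw [relIndex_cotrajectory_of_le_map hD, ← coverMincard_leftCosetRel] at hle
  rw [pow_succ']
  exact mul_le_mul_right (by exact_mod_cast ENat.toENNReal_mono hle) _

theorem coverEntropyEntourage_add_le {H U : Subgroup G} (hφ : H.map φ ≤ H)
    (hU : NormalOrNormalizes H U) (hfin : ∀ n, (cotrajectory φ U n).relIndex U ≠ 0) :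
    coverEntropyEntourage φ (U ⊓ H : Subgroup G) (leftCosetRel U) +
        coverEntropyEntourage φ (U ⊔ H : Subgroup G) (leftCosetRel (U ⊔ H)) ≤
      coverEntropyEntourage φ U (leftCosetRel U) := by
  have hfin' (n : ℕ) : (cotrajectory φ (U ⊔ H) n).relIndex (U ⊔ H) ≠ 0 := by
    rw [hU.relIndex_sup (le_cotrajectory hφ le_sup_right n)]
    exact mt (relIndex_eq_zero_of_le_left (cotrajectory_mono le_sup_left n)) (hfin n)
  rw [← coverEntropyInfEntourage_eq_coverEntropyEntourage hfin']
  refine le_expGrowthSup_mul.trans (expGrowthSup_monotone fun n => ?_)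
  have hfinH : (cotrajectory φ U n).relIndex (U ⊓ H) ≠ 0 :=
    mt (relIndex_eq_zero_of_le_right inf_le_left) (hfin n)
  rw [Pi.mul_apply, coverMincard_subgroup_leftCosetRel (hfin n),
    coverMincard_subgroup_leftCosetRel (hfin' n), coverMincard_subgroup_leftCosetRel hfinH]
  simp only [ENat.toENNReal_coe]
  exact_mod_cast relIndex_cotrajectory_mul_le hφ hU (hfin n)

end CoverEntropy

section HoodEntropy

theorem hoodEntropy_comap {X Y : Type*} (u : UniformSpace X) {S : Y → Y} {T : X → X} {p : Y → X}
    (h : Function.Semiconj p S T) :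
    @hoodEntropy Y (u.comap p) S =
      ⨆ (K : Set X) (_ : IsCompact K ∧ K ⊆ Set.range p), coverEntropy T K := by
  let _ : UniformSpace Y := u.comap p
  have hp : IsInducing p := ⟨rfl⟩
  refine le_antisymm (iSup₂_le fun K hK => ?_) (iSup₂_le fun K ⟨hK, hKp⟩ => ?_)
  · rw [← coverEntropy_image_of_comap u h K]
    exact le_iSup₂_of_le (p '' K) ⟨hp.isCompact_iff.1 hK, Set.image_subset_range p K⟩ le_rfl
  · obtain ⟨K, rfl⟩ := Set.subset_range_iff_exists_image_eq.1 hKp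
    rw [coverEntropy_image_of_comap u h K]
    exact le_iSup₂_of_le K (hp.isCompact_iff.2 hK) le_rfl

theorem hoodEntropy_comap_of_surjective {X Y : Type*} (u : UniformSpace X) {S : Y → Y} {T : X → X}
    {p : Y → X} (h : Function.Semiconj p S T) (hp : Function.Surjective p) :
    @hoodEntropy Y (u.comap p) S = hoodEntropy T := by
  rw [hoodEntropy_comap u h, hoodEntropy]
  simp only [hp.range_eq, Set.subset_univ, and_true]

theorem finite_image_mk_of_totallyBounded {G : Type*} [Group G] [UniformSpace G] {W : Subgroup G}
    {F : Set G} (hF : TotallyBounded F) (hW : leftCosetRel W ∈ 𝓤 G) :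
    (QuotientGroup.mk '' F : Set (G ⧸ W)).Finite := by
  obtain ⟨t, ht, hFt⟩ := hF _ hW
  refine (ht.image QuotientGroup.mk).subset (Set.image_subset_iff.2 fun x hx => ?_)
  obtain ⟨y, hy, hxy⟩ := Set.mem_iUnion₂.1 (hFt hx)
  exact ⟨y, hy, (QuotientGroup.eq.2 hxy).symm⟩

theorem iSup_coverEntropy_eq_of_hasBasis {G ι : Type*} [Group G] [UniformSpace G] {φ : G →* G}
    {L : Subgroup G} {p : ι → Prop} {B : ι → Subgroup G}
    (hB : (𝓤 G).HasBasis p fun i => leftCosetRel (B i))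
    (hc : ∀ i, p i → IsCompact ((B i ⊓ L : Subgroup G) : Set G)) :
    ⨆ (K : Set G) (_ : IsCompact K ∧ K ⊆ L), coverEntropy φ K =
      ⨆ (i) (_ : p i), coverEntropyEntourage φ (B i ⊓ L : Subgroup G) (leftCosetRel (B i)) := by
  refine le_antisymm (iSup₂_le fun K ⟨hK, hKL⟩ => ?_) (iSup₂_le fun i hi => ?_)
  · rw [coverEntropy_eq_iSup_basis hB]
    exact iSup₂_mono fun i hi => coverEntropyEntourage_leftCosetRel_le
      (finite_image_mk_of_totallyBounded hK.totallyBounded (hB.mem_of_mem hi)) hKL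
  · exact le_iSup₂_of_le _ ⟨hc i hi, inf_le_right⟩
      (coverEntropyEntourage_le_coverEntropy φ _ (hB.mem_of_mem hi))

theorem hoodEntropy_eq_of_hasBasis {G ι : Type*} [Group G] [UniformSpace G] {φ : G →* G}
    {p : ι → Prop} {B : ι → Subgroup G} (hB : (𝓤 G).HasBasis p fun i => leftCosetRel (B i))
    (hc : ∀ i, p i → IsCompact (B i : Set G)) :
    hoodEntropy φ = ⨆ (i) (_ : p i), coverEntropyEntourage φ (B i) (leftCosetRel (B i)) := by
  simpa [hoodEntropy] using
    iSup_coverEntropy_eq_of_hasBasis (φ := φ) (L := ⊤) hB (by simpa using hc)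

theorem hoodEntropy_eq_of_hasBasis_comap {G X ι : Type*} [Group G] [u : UniformSpace X] {φ : G →* G}
    {T : X → X} {π : G → X} (h : Function.Semiconj π φ T) (hπ : Function.Surjective π)
    {p : ι → Prop} {B : ι → Subgroup G}
    (hB : ((𝓤 X).comap (Prod.map π π)).HasBasis p fun i => leftCosetRel (B i))
    (hc : ∀ i, p i → IsCompact (π '' B i)) :
    hoodEntropy T = ⨆ (i) (_ : p i), coverEntropyEntourage φ (B i) (leftCosetRel (B i)) := by
  rw [← hoodEntropy_comap_of_surjective u h hπ]
  let _ : UniformSpace G := u.comap π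
  exact hoodEntropy_eq_of_hasBasis hB fun i hi => (IsInducing.mk rfl).isCompact_iff.2 (hc i hi)

end HoodEntropy

section BackwardCore

/-- The intersection of all the groups `trajectoryEnd φ U n`. For compact `U` it consists of the
endpoints of infinite backward trajectories in `U`, and is the subgroup denoted `U₊` in Willis's
theory of the scale. -/
def backwardCore {G : Type*} [Group G] (φ : G →* G) (U : Subgroup G) : Subgroup G :=
  ⨅ n, trajectoryEnd φ U n

variable {G : Type*} [Group G] {φ : G →* G} {H U : Subgroup G}

theorem backwardCore_le_trajectoryEnd (n : ℕ) : backwardCore φ U ≤ trajectoryEnd φ U n :=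
  iInf_le _ n

theorem backwardCore_le : backwardCore φ U ≤ U :=
  backwardCore_le_trajectoryEnd 0

theorem map_backwardCore_inf_le : (backwardCore φ U).map φ ⊓ U ≤ backwardCore φ U := by
  rw [inf_comm]
  refine le_iInf fun n => ?_
  exact (inf_le_inf_left U (Subgroup.map_mono (backwardCore_le_trajectoryEnd n))).trans
    (trajectoryEnd_antitone n.le_succ)

theorem NormalOrNormalizes.backwardCore (hU : NormalOrNormalizes H U) (hφ : H.map φ = H) :
    NormalOrNormalizes H (backwardCore φ U) := by
  refine NormalOrNormalizes.iInf fun n => ?_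
  induction n with
  | zero => exact hU
  | succ n ih => exact hU.inf (ih.map hφ)

variable [TopologicalSpace G] [T2Space G]

theorem isCompact_trajectoryEnd (hφ : Continuous φ) (hU : IsCompact (U : Set G)) (n : ℕ) :
    IsCompact (trajectoryEnd φ U n : Set G) := by
  induction n with
  | zero => exact hU
  | succ n ih => exact hU.inter (ih.image hφ)

theorem isCompact_backwardCore (hφ : Continuous φ) (hU : IsCompact (U : Set G)) :
    IsCompact (backwardCore φ U : Set G) := by
  rw [backwardCore, coe_iInf]
  exact hU.of_isClosed_subset (isClosed_iInter fun n => (isCompact_trajectoryEnd hφ hU n).isClosed)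
    (Set.iInter_subset _ 0)

theorem exists_mem_backwardCore (hφ : Continuous φ) (hU : IsCompact (U : Set G)) {S : Set G}
    (hS : IsClosed S) (h : ∀ n, ∃ y ∈ trajectoryEnd φ U n, φ y ∈ S) :
    ∃ y ∈ backwardCore φ U, φ y ∈ S := by
  have hc := isCompact_trajectoryEnd hφ hU
  have hS' := hS.preimage hφ
  obtain ⟨y, hy⟩ := IsCompact.nonempty_iInter_of_sequence_nonempty_isCompact_isClosed
    (fun n => (trajectoryEnd φ U n : Set G) ∩ φ ⁻¹' S)
    (fun n => Set.inter_subset_inter_left _ (trajectoryEnd_antitone n.le_succ))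
    h ((hc 0).inter_right hS') (fun n => (hc n).isClosed.inter hS')
  rw [Set.mem_iInter] at hy
  exact ⟨y, mem_iInf.2 fun n => (hy n).1, (hy 0).2⟩

theorem backwardCore_le_map (hφ : Continuous φ) (hU : IsCompact (U : Set G)) :
    backwardCore φ U ≤ (backwardCore φ U).map φ := fun x hx =>
  exists_mem_backwardCore hφ hU (isClosed_singleton (x := x)) fun n =>
    (backwardCore_le_trajectoryEnd (n + 1) hx).2

theorem relIndex_map_backwardCore [ContinuousMul G] (hφ : Continuous φ)
    (hU : IsCompact (U : Set G)) {α : ℕ} (hα : α ≠ 0)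
    (hlim : ∀ᶠ n in atTop, U.relIndex ((trajectoryEnd φ U n).map φ) = α) :
    (backwardCore φ U).relIndex ((backwardCore φ U).map φ) = α := by
  obtain ⟨N, hN⟩ := eventually_atTop.1 hlim
  have hcore : (backwardCore φ U).map φ ⊓ U = backwardCore φ U :=
    map_backwardCore_inf_le.antisymm (le_inf (backwardCore_le_map hφ hU) backwardCore_le)
  have hindex := inf_relIndex_left ((backwardCore φ U).map φ) U
  rw [hcore] at hindex
  rw [hindex, ← hN N le_rfl]
  -- Since the index is constant from `N` on, every coset of `U` meeting `φ (trajectoryEnd φ U N)`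
  -- meets all the later images, hence by compactness the image of the intersection.
  refine relIndex_eq_of_subset_mul (Subgroup.map_mono (backwardCore_le_trajectoryEnd N))
    fun x hx => ?_
  suffices h : ∃ y ∈ backwardCore φ U, φ y ∈ {z | x⁻¹ * z ∈ U} by
    obtain ⟨y, hy, hxy⟩ := h
    exact ⟨φ y, mem_map_of_mem φ hy, (φ y)⁻¹ * x, by simpa using U.inv_mem hxy,
      mul_inv_cancel_left _ _⟩
  refine exists_mem_backwardCore hφ hU (hU.isClosed.preimage (continuous_const_mul x⁻¹))
    fun n => ?_
  have hsub : ((trajectoryEnd φ U N).map φ : Set G) ⊆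
      ((trajectoryEnd φ U (max n N)).map φ : Subgroup G) * U :=
    subset_mul_of_relIndex_eq (Subgroup.map_mono (trajectoryEnd_antitone (le_max_right n N)))
      (by rwa [hN N le_rfl]) ((hN _ (le_max_right n N)).trans (hN N le_rfl).symm)
  obtain ⟨_, ⟨y, hy, rfl⟩, u, hu, rfl⟩ := hsub hx
  exact ⟨y, trajectoryEnd_antitone (le_max_left n N) hy, by simpa using U.inv_mem hu⟩

end BackwardCore

section OpenSubgroups

/-- The largest subgroup of `U` normalized by `H`: the normal core, with only the elements of `H`
conjugating. -/
def conjCore {G : Type*} [Group G] (H U : Subgroup G) : Subgroup G :=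
  ⨅ h : H, U.comap (MulAut.conj (h : G)).toMonoidHom

variable {G : Type*} [Group G] {H U : Subgroup G}

theorem mem_conjCore {x : G} : x ∈ conjCore H U ↔ ∀ h ∈ H, h * x * h⁻¹ ∈ U := by
  simp [conjCore]

theorem conjCore_le : conjCore H U ≤ U := fun x hx => by
  simpa using mem_conjCore.1 hx 1 H.one_mem

theorem le_normalizer_conjCore : H ≤ normalizer (conjCore H U : Set G) := by
  refine le_normalizer_iff.2 fun h hh x hx => mem_conjCore.2 fun k hk => ?_
  simpa [mul_assoc] using mem_conjCore.1 hx (k * h) (H.mul_mem hk hh)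

variable [TopologicalSpace G]

theorem isOpen_cotrajectory {φ : G →* G} (hφ : Continuous φ) (hU : IsOpen (U : Set G)) (n : ℕ) :
    IsOpen (cotrajectory φ U n : Set G) := by
  induction n with
  | zero => exact isOpen_univ
  | succ n ih => exact hU.inter (ih.preimage hφ)

variable [IsTopologicalGroup G]

theorem isOpen_conjCore (hH : IsCompact (H : Set G)) (hU : IsOpen (U : Set G)) :
    IsOpen (conjCore H U : Set G) := by
  have hconj : ∀ᶠ x in 𝓝 (1 : G), ∀ h ∈ (H : Set G), h * x * h⁻¹ ∈ U := by
    refine hH.eventually_forall_of_forall_eventually fun h _ => ?_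
    have hcont : Continuous fun p : G × G => p.2 * p.1 * p.2⁻¹ := by fun_prop
    exact hcont.continuousAt.eventually (hU.mem_nhds (by simp))
  exact isOpen_of_mem_nhds _ (hconj.mono fun x hx => mem_conjCore.2 hx)

theorem isOpen_stabilizer_of_isCompact_of_isOpen {W : Set G} (hWc : IsCompact W) (hW : IsOpen W) :
    IsOpen (MulAction.stabilizer G W : Set G) := by
  have hmul : ∀ᶠ x in 𝓝 (1 : G), ∀ w ∈ W, x * w ∈ W :=
    hWc.eventually_forall_of_forall_eventually fun w hw =>
      (continuous_mul (M := G)).continuousAt.eventually (hW.mem_nhds (by simpa using hw))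
  have hinv : ∀ᶠ x in 𝓝 (1 : G), ∀ w ∈ W, x⁻¹ * w ∈ W :=
    (continuous_inv.tendsto' (1 : G) 1 inv_one).eventually hmul
  refine isOpen_of_mem_nhds _ (g := 1) ?_
  filter_upwards [hmul, hinv] with x hx hx'
  refine MulAction.mem_stabilizer_iff.2 (Set.Subset.antisymm (Set.smul_set_subset_iff.2 hx) ?_)
  exact fun w hw => Set.mem_smul_set_iff_inv_smul_mem.2 (hx' w hw)

theorem exists_isOpen_isCompact_subgroup_subset [T2Space G] [LocallyCompactSpace G]
    [TotallyDisconnectedSpace G] {O : Set G} (hO : O ∈ 𝓝 (1 : G)) :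
    ∃ U : Subgroup G, IsOpen (U : Set G) ∧ IsCompact (U : Set G) ∧ (U : Set G) ⊆ O := by
  obtain ⟨K, hK, hKO, hKc⟩ := local_compact_nhds hO
  obtain ⟨W, hW, h1W, hWK⟩ :=
    (loc_compact_Haus_tot_disc_of_zero_dim (H := G)).mem_nhds_iff.1 hK
  have hWc : IsCompact W := hKc.of_isClosed_subset hW.isClosed hWK
  have hsub : (MulAction.stabilizer G W : Set G) ⊆ W := fun x hx => by
    simpa [MulAction.mem_stabilizer_iff.1 hx] using Set.smul_mem_smul_set (a := x) h1W
  have hopen := isOpen_stabilizer_of_isCompact_of_isOpen hWc hW.isOpen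
  exact ⟨_, hopen, hWc.of_isClosed_subset (isClosed_of_isOpen _ hopen) hsub,
    hsub.trans (hWK.trans hKO)⟩

theorem relIndex_ne_zero_of_isOpen_of_isCompact {A K : Subgroup G} (hA : IsOpen (A : Set G))
    (hK : IsCompact (K : Set G)) : A.relIndex K ≠ 0 := by
  have : CompactSpace K := isCompact_iff_compactSpace.1 hK
  have : Finite (K ⧸ A.subgroupOf K) :=
    quotient_finite_of_isOpen _ (hA.preimage continuous_subtype_val)
  exact Nat.card_pos.ne'

theorem exists_nhds_one_inter_subset {D E : Subgroup G} (hD : IsClosed (D : Set G))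
    (h0 : D.relIndex E ≠ 0) : ∃ O ∈ 𝓝 (1 : G), O ∩ E ⊆ D := by
  have : (D.subgroupOf E).FiniteIndex := ⟨h0⟩
  have hopen : IsOpen (D.subgroupOf E : Set E) :=
    isOpen_of_isClosed_of_finiteIndex _ (hD.preimage continuous_subtype_val)
  have hmem := hopen.mem_nhds (D.subgroupOf E).one_mem
  rw [nhds_subtype_eq_comap] at hmem
  obtain ⟨O, hO, hOD⟩ := hmem
  exact ⟨O, hO, fun x ⟨hx, hxE⟩ => hOD (a := ⟨x, hxE⟩) hx⟩

end OpenSubgroups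

/-- The compact open subgroups `U` for which `U * H` is a subgroup because `H` is normal or
normalizes `U`. In a totally disconnected locally compact group they form a basis of neighbourhoods
of `1` when `H` is normal or compact. -/
structure IsAdapted {G : Type*} [Group G] [TopologicalSpace G] (H U : Subgroup G) : Prop where
  isOpen : IsOpen (U : Set G)
  isCompact : IsCompact (U : Set G)
  normalOrNormalizes : NormalOrNormalizes H U

section IsAdapted

variable {G : Type*} [Group G] [TopologicalSpace G] {H U V : Subgroup G}

theorem IsAdapted.inf [T2Space G] (hU : IsAdapted H U) (hV : IsAdapted H V) :
    IsAdapted H (U ⊓ V) :=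
  ⟨hU.isOpen.inter hV.isOpen, hU.isCompact.inter hV.isCompact,
    hU.normalOrNormalizes.inf hV.normalOrNormalizes⟩

variable [IsTopologicalGroup G]

theorem IsAdapted.relIndex_cotrajectory_ne_zero {φ : G →* G} (hU : IsAdapted H U)
    (hφ : Continuous φ) (n : ℕ) : (cotrajectory φ U n).relIndex U ≠ 0 :=
  relIndex_ne_zero_of_isOpen_of_isCompact (isOpen_cotrajectory hφ hU.isOpen n) hU.isCompact

theorem IsAdapted.relIndex_map_backwardCore_ne_zero [T2Space G] {φ : G →* G} (hU : IsAdapted H U)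
    (hφ : Continuous φ) : (backwardCore φ U).relIndex ((backwardCore φ U).map φ) ≠ 0 := by
  obtain ⟨α, hα, hlim⟩ :=
    exists_eventually_relIndex_map_trajectoryEnd (hU.relIndex_cotrajectory_ne_zero hφ)
  rwa [relIndex_map_backwardCore hφ hU.isCompact hα hlim]

theorem IsAdapted.coverEntropyEntourage_eq_log [T2Space G] {φ : G →* G} (hU : IsAdapted H U)
    (hφ : Continuous φ) : coverEntropyEntourage φ U (leftCosetRel U) =
      ENNReal.log ((backwardCore φ U).relIndex ((backwardCore φ U).map φ)) := by
  have hfin := hU.relIndex_cotrajectory_ne_zero hφ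
  obtain ⟨α, hα, hlim⟩ := exists_eventually_relIndex_map_trajectoryEnd hfin
  rw [relIndex_map_backwardCore hφ hU.isCompact hα hlim,
    _root_.coverEntropyEntourage_eq_log hfin hlim]

variable [T2Space G] [LocallyCompactSpace G] [TotallyDisconnectedSpace G]

theorem exists_isAdapted_subset (hH : H.Normal ∨ IsCompact (H : Set G)) {O : Set G}
    (hO : O ∈ 𝓝 (1 : G)) : ∃ U : Subgroup G, IsAdapted H U ∧ (U : Set G) ⊆ O := by
  obtain ⟨U, hUo, hUc, hUO⟩ := exists_isOpen_isCompact_subgroup_subset hO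
  rcases hH with hN | hC
  · exact ⟨U, ⟨hUo, hUc, Or.inl hN⟩, hUO⟩
  · have hopen := isOpen_conjCore hC hUo
    exact ⟨conjCore H U, ⟨hopen, hUc.of_isClosed_subset (isClosed_of_isOpen _ hopen) conjCore_le,
      Or.inr le_normalizer_conjCore⟩, Set.Subset.trans conjCore_le hUO⟩

theorem hasBasis_nhds_one_isAdapted (hH : H.Normal ∨ IsCompact (H : Set G)) :
    (𝓝 (1 : G)).HasBasis (IsAdapted H) (fun U => (U : Set G)) := by
  refine ⟨fun O => ⟨exists_isAdapted_subset hH, ?_⟩⟩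
  rintro ⟨U, hU, hUO⟩
  exact mem_of_superset (hU.isOpen.mem_nhds U.one_mem) hUO

end IsAdapted

section EntropyFormulas

variable {G : Type*} [Group G]

theorem preimage_image_mk_leftCosetRel {H U : Subgroup G} (hU : NormalOrNormalizes H U) :
    Prod.map QuotientGroup.mk QuotientGroup.mk ⁻¹'
        (Prod.map QuotientGroup.mk QuotientGroup.mk '' leftCosetRel U : SetRel (G ⧸ H) (G ⧸ H)) =
      leftCosetRel (U ⊔ H) := by
  ext ⟨x, y⟩
  constructor
  · rintro ⟨⟨x', y'⟩, hxy, he⟩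
    simp only [Prod.map_apply, Prod.mk.injEq, QuotientGroup.eq] at he
    have hmem := mul_mem (mul_mem (inv_mem (le_sup_right (a := U) he.1))
      (le_sup_left (b := H) hxy)) (le_sup_right (a := U) he.2)
    simpa [leftCosetRel, mul_assoc] using hmem
  · intro hxy
    obtain ⟨u, hu, h, hh, huh⟩ := hU.coe_sup.subset hxy
    have hxu : x * u = y * h⁻¹ := by
      rw [eq_mul_inv_iff_mul_eq, mul_assoc]
      exact mul_eq_of_eq_inv_mul huh
    refine ⟨(x, x * u), by simpa [leftCosetRel] using hu, ?_⟩
    rw [Prod.map_apply, Prod.map_apply, Prod.mk.injEq]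
    exact ⟨rfl, QuotientGroup.eq.2 (by simpa [hxu] using hh)⟩

variable [TopologicalSpace G] [IsTopologicalGroup G] [T2Space G] [LocallyCompactSpace G]
  [TotallyDisconnectedSpace G] {φ : G →* G} {H : Subgroup G}

theorem hasBasis_uniformity_leftUniformSpace (hH : H.Normal ∨ IsCompact (H : Set G)) :
    (@uniformity G (IsTopologicalGroup.leftUniformSpace G)).HasBasis (IsAdapted H) leftCosetRel :=
  (hasBasis_nhds_one_isAdapted hH).comap _

theorem hoodEntropy_eq_iSup_isAdapted (hH : H.Normal ∨ IsCompact (H : Set G)) :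
    @hoodEntropy G (IsTopologicalGroup.leftUniformSpace G) φ =
      ⨆ (U) (_ : IsAdapted H U), coverEntropyEntourage φ U (leftCosetRel U) := by
  let _ : UniformSpace G := IsTopologicalGroup.leftUniformSpace G
  exact hoodEntropy_eq_of_hasBasis (hasBasis_uniformity_leftUniformSpace hH) fun U hU =>
    hU.isCompact

theorem hoodEntropy_restrictMap_eq_iSup_isAdapted (hclosed : IsClosed (H : Set G))
    (hmap : H.map φ ≤ H) (hH : H.Normal ∨ IsCompact (H : Set G)) :
    @hoodEntropy H (IsTopologicalGroup.leftUniformSpace H) (restrictMap φ H hmap) =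
      ⨆ (U) (_ : IsAdapted H U),
        coverEntropyEntourage φ (U ⊓ H : Subgroup G) (leftCosetRel U) := by
  let _ : UniformSpace G := IsTopologicalGroup.leftUniformSpace G
  have hu : IsTopologicalGroup.leftUniformSpace H =
      UniformSpace.comap Subtype.val (IsTopologicalGroup.leftUniformSpace G) := by
    refine UniformSpace.ext ?_
    change comap _ _ = comap _ (comap _ _)
    rw [nhds_subtype_eq_comap, comap_comap, comap_comap]
    rfl
  rw [hu, hoodEntropy_comap _ (S := restrictMap φ H hmap) (T := φ) fun _ => rfl,
    Subtype.range_coe_subtype]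
  exact iSup_coverEntropy_eq_of_hasBasis (hasBasis_uniformity_leftUniformSpace hH) fun U hU =>
    hU.isCompact.inter_right hclosed

theorem hoodEntropy_quotientMap_eq_iSup_isAdapted (hmap : H.map φ ≤ H)
    (hH : H.Normal ∨ IsCompact (H : Set G)) :
    @hoodEntropy (G ⧸ H) (quotientLeftUniformSpace H hH) (quotientMap φ H hmap) =
      ⨆ (U) (_ : IsAdapted H U),
        coverEntropyEntourage φ (U ⊔ H : Subgroup G) (leftCosetRel (U ⊔ H)) := by
  let _ : UniformSpace (G ⧸ H) := quotientLeftUniformSpace H hH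
  have hbasis : (𝓤 (G ⧸ H)).HasBasis (IsAdapted H) fun U =>
      Prod.map QuotientGroup.mk QuotientGroup.mk '' leftCosetRel U :=
    (hasBasis_uniformity_leftUniformSpace hH).map _
  have hpull : ((𝓤 (G ⧸ H)).comap (Prod.map QuotientGroup.mk QuotientGroup.mk)).HasBasis
      (IsAdapted H) fun U => leftCosetRel (U ⊔ H) :=
    (hbasis.comap _).congr (fun _ => Iff.rfl) fun U hU =>
      preimage_image_mk_leftCosetRel hU.normalOrNormalizes
  have hsemi : Function.Semiconj QuotientGroup.mk φ (quotientMap φ H hmap) := fun _ => rfl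
  refine hoodEntropy_eq_of_hasBasis_comap hsemi QuotientGroup.mk_surjective
    (B := fun U => U ⊔ H) hpull fun U hU => ?_
  rw [hU.normalOrNormalizes.image_mk_sup le_rfl]
  exact hU.isCompact.image continuous_quot_mk

end EntropyFormulas

section AdditionTheorem

variable {G : Type*} [Group G] [TopologicalSpace G] [IsTopologicalGroup G] [T2Space G]
  [LocallyCompactSpace G] [TotallyDisconnectedSpace G] {φ : G →* G} {H U : Subgroup G}

theorem hoodEntropy_add_le (hφ : Continuous φ) (hclosed : IsClosed (H : Set G))
    (hmap : H.map φ ≤ H) (hH : H.Normal ∨ IsCompact (H : Set G)) :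
    @hoodEntropy H (IsTopologicalGroup.leftUniformSpace H) (restrictMap φ H hmap) +
        @hoodEntropy (G ⧸ H) (quotientLeftUniformSpace H hH) (quotientMap φ H hmap) ≤
      @hoodEntropy G (IsTopologicalGroup.leftUniformSpace G) φ := by
  rw [hoodEntropy_eq_iSup_isAdapted hH, hoodEntropy_restrictMap_eq_iSup_isAdapted hclosed hmap hH,
    hoodEntropy_quotientMap_eq_iSup_isAdapted hmap hH]
  refine EReal.add_le_of_forall_lt fun a ha b hb => ?_
  simp only [lt_iSup_iff, exists_prop] at ha hb
  obtain ⟨U₁, hU₁, ha⟩ := ha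
  obtain ⟨U₂, hU₂, hb⟩ := hb
  have hU := hU₁.inf hU₂
  have hrestrict : coverEntropyEntourage φ (U₁ ⊓ H : Subgroup G) (leftCosetRel U₁) ≤
      coverEntropyEntourage φ (U₁ ⊓ U₂ ⊓ H : Subgroup G) (leftCosetRel (U₁ ⊓ U₂)) :=
    coverEntropyEntourage_leftCosetRel_anti inf_le_left
      (relIndex_ne_zero_of_isOpen_of_isCompact hU.isOpen (hU₁.isCompact.inter_right hclosed))
  have hquotient : coverEntropyEntourage φ (U₂ ⊔ H : Subgroup G) (leftCosetRel (U₂ ⊔ H)) ≤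
      coverEntropyEntourage φ (U₁ ⊓ U₂ ⊔ H : Subgroup G) (leftCosetRel (U₁ ⊓ U₂ ⊔ H)) := by
    have h0 : (U₁ ⊓ U₂ ⊔ H).relIndex (U₂ ⊔ H) ≠ 0 := by
      rw [hU₂.normalOrNormalizes.relIndex_sup le_sup_right]
      exact relIndex_ne_zero_of_isOpen_of_isCompact (isOpen_mono le_sup_left hU.isOpen)
        hU₂.isCompact
    simpa using coverEntropyEntourage_leftCosetRel_anti (φ := φ) (L := ⊤)
      (sup_le_sup_right (inf_le_right (a := U₁)) H) (by simpa using h0)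
  calc a + b ≤ _ := add_le_add (ha.le.trans hrestrict) (hb.le.trans hquotient)
    _ ≤ coverEntropyEntourage φ (U₁ ⊓ U₂ : Subgroup G) (leftCosetRel (U₁ ⊓ U₂)) :=
      coverEntropyEntourage_add_le hmap hU.normalOrNormalizes (hU.relIndex_cotrajectory_ne_zero hφ)
    _ ≤ _ := le_iSup₂_of_le _ hU le_rfl

theorem log_relIndex_map_backwardCore_inf_le (hφ : Continuous φ) (hclosed : IsClosed (H : Set G))
    (hstable : H.map φ = H) (hker : φ.ker ≤ H) (hH : H.Normal ∨ IsCompact (H : Set G))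
    (hU : IsAdapted H U) :
    ENNReal.log ((backwardCore φ U).relIndex ((backwardCore φ U).map φ ⊓ H)) ≤
      @hoodEntropy H (IsTopologicalGroup.leftUniformSpace H) (restrictMap φ H hstable.le) := by
  have hmap : (backwardCore φ U ⊓ H).map φ = (backwardCore φ U).map φ ⊓ H :=
    map_inf_of_ker_le hstable hker _
  have hD : backwardCore φ U ⊓ H ≤ (backwardCore φ U ⊓ H).map φ := by
    rw [hmap]
    exact inf_le_inf_right H (backwardCore_le_map hφ hU.isCompact)
  have hDU : (backwardCore φ U ⊓ H).map φ ⊓ U ≤ backwardCore φ U ⊓ H := by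
    rw [hmap, inf_right_comm]
    exact inf_le_inf_right H map_backwardCore_inf_le
  have hindex : (backwardCore φ U ⊓ H).relIndex ((backwardCore φ U ⊓ H).map φ) =
      (backwardCore φ U).relIndex ((backwardCore φ U).map φ ⊓ H) := by
    rw [hmap, ← inf_relIndex_right, ← inf_relIndex_right (backwardCore φ U)]
    congr 1
    rw [inf_assoc, inf_left_comm H, inf_idem]
  have h1 : U.relIndex (backwardCore φ U ⊓ H) ≠ 0 := by
    rw [relIndex_eq_one.2 (inf_le_left.trans backwardCore_le)]
    exact one_ne_zero
  rw [hoodEntropy_restrictMap_eq_iSup_isAdapted hclosed hstable.le hH, ← hindex]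
  exact le_iSup₂_of_le U hU ((log_relIndex_le_coverEntropyEntourage hD hDU).trans
    (coverEntropyEntourage_subgroup_leftCosetRel_le h1 inf_le_right))

theorem log_relIndex_map_backwardCore_sup_le (hφ : Continuous φ) (hclosed : IsClosed (H : Set G))
    (hstable : H.map φ = H) (hH : H.Normal ∨ IsCompact (H : Set G)) (hU : IsAdapted H U)
    (h0 : (backwardCore φ U ⊔ H).relIndex ((backwardCore φ U).map φ ⊔ H) ≠ 0) :
    ENNReal.log ((backwardCore φ U ⊔ H).relIndex ((backwardCore φ U).map φ ⊔ H)) ≤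
      @hoodEntropy (G ⧸ H) (quotientLeftUniformSpace H hH) (quotientMap φ H hstable.le) := by
  have hcpt := isCompact_backwardCore hφ hU.isCompact
  have hcore := hU.normalOrNormalizes.backwardCore hstable
  have hmap : (backwardCore φ U ⊔ H).map φ = (backwardCore φ U).map φ ⊔ H := by
    rw [Subgroup.map_sup, hstable]
  rw [← hmap] at h0 ⊢
  have hDclosed : IsClosed ((backwardCore φ U ⊔ H : Subgroup G) : Set G) := by
    rw [hcore.coe_sup]
    exact hclosed.mul_left_of_isCompact hcpt
  -- `U` itself need not satisfy `φ (U₊ H) ∩ UH ≤ U₊ H`, but a smaller group `V` does, because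
  -- `U₊ H` is open in `φ (U₊ H)`.
  obtain ⟨O, hO, hOD⟩ := exists_nhds_one_inter_subset hDclosed h0
  obtain ⟨V, hV, hVO⟩ := exists_isAdapted_subset hH hO
  have hD : backwardCore φ U ⊔ H ≤ (backwardCore φ U ⊔ H).map φ := by
    rw [hmap]
    exact sup_le_sup_right (backwardCore_le_map hφ hU.isCompact) H
  have hDV : (backwardCore φ U ⊔ H).map φ ⊓ (V ⊔ H) ≤ backwardCore φ U ⊔ H := by
    rw [← SetLike.coe_subset_coe, coe_inf, hV.normalOrNormalizes.coe_sup,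
      ← inf_mul_assoc _ _ _ (le_sup_right.trans hD), Set.mul_subset_iff]
    exact fun x hx h hh => mul_mem (hOD ⟨hVO hx.2, hx.1⟩) (le_sup_right (a := backwardCore φ U) hh)
  have h1 : (V ⊔ H).relIndex (backwardCore φ U ⊔ H) ≠ 0 := by
    rw [hcore.relIndex_sup le_sup_right]
    exact relIndex_ne_zero_of_isOpen_of_isCompact (isOpen_mono le_sup_left hV.isOpen) hcpt
  rw [hoodEntropy_quotientMap_eq_iSup_isAdapted hstable.le hH]
  refine le_iSup₂_of_le V hV ((log_relIndex_le_coverEntropyEntourage hD hDV).trans ?_)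
  simpa using coverEntropyEntourage_subgroup_leftCosetRel_le (φ := φ) h1 le_top

theorem hoodEntropy_le_add (hφ : Continuous φ) (hclosed : IsClosed (H : Set G))
    (hstable : H.map φ = H) (hker : φ.ker ≤ H) (hH : H.Normal ∨ IsCompact (H : Set G)) :
    @hoodEntropy G (IsTopologicalGroup.leftUniformSpace G) φ ≤
      @hoodEntropy H (IsTopologicalGroup.leftUniformSpace H) (restrictMap φ H hstable.le) +
        @hoodEntropy (G ⧸ H) (quotientLeftUniformSpace H hH) (quotientMap φ H hstable.le) := by
  rw [hoodEntropy_eq_iSup_isAdapted hH]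
  refine iSup₂_le fun U hU => ?_
  have hcore := hU.normalOrNormalizes.backwardCore hstable
  have hmul := hcore.relIndex_eq_mul (hcore.map hstable) (backwardCore_le_map hφ hU.isCompact)
  have h0 := right_ne_zero_of_mul (hmul ▸ hU.relIndex_map_backwardCore_ne_zero hφ)
  rw [hU.coverEntropyEntourage_eq_log hφ, hmul, Nat.cast_mul,
    ENNReal.log_mul_add]
  exact add_le_add (log_relIndex_map_backwardCore_inf_le hφ hclosed hstable hker hH hU)
    (log_relIndex_map_backwardCore_sup_le hφ hclosed hstable hH hU h0)

end AdditionTheorem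

theorem mainTheorem1 {G : Type*} [Group G] [TopologicalSpace G] [IsTopologicalGroup G]
    [T2Space G] [LocallyCompactSpace G] [TotallyDisconnectedSpace G]
    (φ : G →* G) (hφ : Continuous φ)
    (H : Subgroup G) (hclosed : IsClosed (H : Set G))
    (hstable : H.map φ = H) (hker : φ.ker ≤ H)
    (hH : H.Normal ∨ IsCompact (H : Set G)) :
    @hoodEntropy G (IsTopologicalGroup.leftUniformSpace G) φ =
      @hoodEntropy H (IsTopologicalGroup.leftUniformSpace H) (restrictMap φ H hstable.le) +
      @hoodEntropy (G ⧸ H) (quotientLeftUniformSpace H hH) (quotientMap φ H hstable.le) :=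
  (hoodEntropy_le_add hφ hclosed hstable hker hH).antisymm
    (hoodEntropy_add_le hφ hclosed hstable.le hH)
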